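/- For $a=(a_1,\dots,a_4)$ and $b=(b_1,\dots,b_4)$ in $\mathbb C^4$ put $$f(u,v)=a_1u(u^2+v^2)+a_2u+a_3v+a_4,\qquad g(u,v)=b_1v(u^2+v^2)+b_2u+b_3v+b_4 .$$ For general parameters $(a,b)\in\mathbb C^8$ we have $$\#\{(u,v)\in\mathbb C^2 \mid f(u,v)=g(u,v)=0\}=5 .$$ Here "general" means that the set of parameters $(a,b)$ for which the statement fails is contained in the vanishing set of a system of polynomials on $\mathbb C^8$, and this vanishing set is not all of $\mathbb C^8$. Moreover, there are choices $(a,b)\in\mathbb R^8$ for which the system $f=g=0$ has exactly five solutions in $\mathbb C^2$ and all five of them are real, i.e. lie in $\mathbb R^2$. -/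

import Mathlib

/-- The first polynomial of a single oscillator,
`f(u,v) = a₁ u (u² + v²) + a₂ u + a₃ v + a₄`; the entry `a i` is `a_{i+1}`. -/
def oscillatorF (a : Fin 4 → ℂ) (u v : ℂ) : ℂ :=
  a 0 * u * (u ^ 2 + v ^ 2) + a 1 * u + a 2 * v + a 3

/-- The second polynomial of a single oscillator,
`g(u,v) = b₁ v (u² + v²) + b₂ u + b₃ v + b₄`; the entry `b i` is `b_{i+1}`. -/
def oscillatorG (b : Fin 4 → ℂ) (u v : ℂ) : ℂ :=
  b 0 * v * (u ^ 2 + v ^ 2) + b 1 * u + b 2 * v + b 3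

/-- All complex solutions of the system `f = g = 0` with parameters `(a, b) ∈ ℂ⁸`. -/
def oscillatorSolutions (a b : Fin 4 → ℂ) : Set (ℂ × ℂ) :=
  {x | oscillatorF a x.1 x.2 = 0 ∧ oscillatorG b x.1 x.2 = 0}

/-- A property holds for general points of `ℂ^σ` if the set of points where it fails is contained
in a strict subvariety: the vanishing set of a system of polynomials that is not all of `ℂ^σ`. -/
def HoldsForGeneral {σ : Type} (P : (σ → ℂ) → Prop) : Prop :=
  ∃ S : Set (MvPolynomial σ ℂ),
    {p : σ → ℂ | ∀ q ∈ S, MvPolynomial.eval p q = 0} ≠ Set.univ ∧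
    {p : σ → ℂ | ¬ P p} ⊆ {p : σ → ℂ | ∀ q ∈ S, MvPolynomial.eval p q = 0}

/-! Once `r = u² + v²` is fixed, the system is linear in `(u, v)`. Cramer's rule gives `u =
U(r)/D(r)`, `v = V(r)/D(r)`, and `r = u² + v²` becomes the quintic `r D² - U² - V² = 0`. If it has
degree 5, is separable and is coprime to `D`, its five roots biject with the solutions. These
conditions follow from the non-vanishing of one polynomial in the parameters, and one explicit point
shows that polynomial is nonzero. -/

open Polynomial

section Eliminant

variable {R : Type*} [CommRing R]

/-- The determinant of the system `f = g = 0`, linear in `(u, v)` once `r = u² + v²` is fixed,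
as a polynomial in `r`. -/
noncomputable def oscillatorDet (a b : Fin 4 → R) : R[X] :=
  (C (a 0) * X + C (a 1)) * (C (b 0) * X + C (b 2)) - C (a 2) * C (b 1)

/-- The Cramer numerator of `u`. -/
noncomputable def oscillatorNumU (a b : Fin 4 → R) : R[X] :=
  C (a 2) * C (b 3) - C (a 3) * (C (b 0) * X + C (b 2))

/-- The Cramer numerator of `v`. -/
noncomputable def oscillatorNumV (a b : Fin 4 → R) : R[X] :=
  C (a 3) * C (b 1) - C (b 3) * (C (a 0) * X + C (a 1))

/-- The quintic satisfied by `r = u² + v²` at every solution `(u, v)`. -/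
noncomputable def oscillatorEliminant (a b : Fin 4 → R) : R[X] :=
  X * oscillatorDet a b ^ 2 - oscillatorNumU a b ^ 2 - oscillatorNumV a b ^ 2

/-- The resultant whose non-vanishing makes the eliminant separable and coprime to the
determinant. -/
noncomputable def oscillatorResultant (a b : Fin 4 → R) : R :=
  (oscillatorEliminant a b).resultant
    (derivative (oscillatorEliminant a b) * oscillatorDet a b) 5 6

theorem map_oscillatorDet {S : Type*} [CommRing S] (φ : R →+* S) (a b : Fin 4 → R) :
    (oscillatorDet a b).map φ = oscillatorDet (φ ∘ a) (φ ∘ b) := by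
  simp [oscillatorDet]

theorem map_oscillatorEliminant {S : Type*} [CommRing S] (φ : R →+* S) (a b : Fin 4 → R) :
    (oscillatorEliminant a b).map φ = oscillatorEliminant (φ ∘ a) (φ ∘ b) := by
  simp [oscillatorEliminant, map_oscillatorDet, oscillatorNumU, oscillatorNumV]

/-- The formal degrees 5 and 6 are fixed, so this survives degree drops; it lets the resultant of
generic parameters be evaluated at a point. -/
theorem map_oscillatorResultant {S : Type*} [CommRing S] (φ : R →+* S) (a b : Fin 4 → R) :
    φ (oscillatorResultant a b) = oscillatorResultant (φ ∘ a) (φ ∘ b) := by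
  rw [oscillatorResultant, ← resultant_map_map, Polynomial.map_mul, ← derivative_map,
    map_oscillatorDet, map_oscillatorEliminant, oscillatorResultant]

theorem natDegree_oscillatorDet_le (a b : Fin 4 → R) : (oscillatorDet a b).natDegree ≤ 2 := by
  unfold oscillatorDet
  compute_degree

theorem natDegree_oscillatorEliminant_le (a b : Fin 4 → R) :
    (oscillatorEliminant a b).natDegree ≤ 5 := by
  unfold oscillatorEliminant oscillatorDet oscillatorNumU oscillatorNumV
  compute_degree

theorem coeff_five_oscillatorEliminant (a b : Fin 4 → R) :
    (oscillatorEliminant a b).coeff 5 = (a 0 * b 0) ^ 2 := by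
  unfold oscillatorEliminant oscillatorDet oscillatorNumU oscillatorNumV
  compute_degree!

theorem natDegree_oscillatorEliminant [IsDomain R] {a b : Fin 4 → R} (h : a 0 * b 0 ≠ 0) :
    (oscillatorEliminant a b).natDegree = 5 :=
  natDegree_eq_of_le_of_coeff_ne_zero (natDegree_oscillatorEliminant_le a b)
    (by rw [coeff_five_oscillatorEliminant]; exact pow_ne_zero 2 h)

end Eliminant

/-- The resultant is a combination of both polynomials; dividing by it gives a Bézout identity. -/
theorem isCoprime_of_oscillatorResultant_ne_zero {K : Type*} [Field K] {a b : Fin 4 → K}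
    (h : oscillatorResultant a b ≠ 0) :
    IsCoprime (oscillatorEliminant a b)
      (derivative (oscillatorEliminant a b) * oscillatorDet a b) := by
  have hP := natDegree_oscillatorEliminant_le a b
  have hQ : (derivative (oscillatorEliminant a b) * oscillatorDet a b).natDegree ≤ 6 :=
    natDegree_mul_le.trans <| Nat.add_le_add (b := 4) (d := 2)
      ((natDegree_derivative_le _).trans (Nat.sub_le_sub_right hP 1)) (natDegree_oscillatorDet_le a b)
  obtain ⟨p, q, -, -, hpq⟩ := exists_mul_add_mul_eq_C_resultant _ _ hP hQ (Or.inl (by norm_num))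
  refine ⟨C (oscillatorResultant a b)⁻¹ * p, C (oscillatorResultant a b)⁻¹ * q, ?_⟩
  have hC : C (oscillatorResultant a b)⁻¹ * C (oscillatorResultant a b) = 1 := by
    rw [← C_mul, inv_mul_cancel₀ h, C_1]
  rw [← hC]
  conv_rhs => rw [oscillatorResultant, ← hpq]
  simp only [oscillatorResultant]
  ring

theorem oscillatorSolutions_eq_image {a b : Fin 4 → ℂ} (h0 : oscillatorEliminant a b ≠ 0)
    (h : IsCoprime (oscillatorEliminant a b) (oscillatorDet a b)) :
    oscillatorSolutions a b =
      (fun r => ((oscillatorNumU a b).eval r / (oscillatorDet a b).eval r,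
        (oscillatorNumV a b).eval r / (oscillatorDet a b).eval r)) ''
      (oscillatorEliminant a b).rootSet ℂ := by
  have hD : ∀ r, (oscillatorEliminant a b).eval r = 0 → (oscillatorDet a b).eval r ≠ 0 := by
    intro r hr hd
    obtain ⟨p, q, hpq⟩ := h
    simpa [hr, hd] using congrArg (eval r) hpq
  ext ⟨u, v⟩
  simp only [Set.mem_image, mem_rootSet_of_ne h0, coe_aeval_eq_eval, Prod.mk.injEq,
    oscillatorSolutions, Set.mem_ofPred_eq, oscillatorF, oscillatorG]
  constructor
  · rintro ⟨hf, hg⟩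
    have hu : u * (oscillatorDet a b).eval (u ^ 2 + v ^ 2) =
        (oscillatorNumU a b).eval (u ^ 2 + v ^ 2) := by
      simp [oscillatorDet, oscillatorNumU]
      linear_combination (b 0 * (u ^ 2 + v ^ 2) + b 2) * hf - a 2 * hg
    have hv : v * (oscillatorDet a b).eval (u ^ 2 + v ^ 2) =
        (oscillatorNumV a b).eval (u ^ 2 + v ^ 2) := by
      simp [oscillatorDet, oscillatorNumV]
      linear_combination (a 0 * (u ^ 2 + v ^ 2) + a 1) * hg - b 1 * hf
    have hr : (oscillatorEliminant a b).eval (u ^ 2 + v ^ 2) = 0 := by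
      simp only [oscillatorEliminant, eval_sub, eval_mul, eval_pow, eval_X, ← hu, ← hv]
      ring
    refine ⟨u ^ 2 + v ^ 2, hr, ?_, ?_⟩
    · rw [← hu, mul_div_cancel_right₀ _ (hD _ hr)]
    · rw [← hv, mul_div_cancel_right₀ _ (hD _ hr)]
  · rintro ⟨r, hr, hu, hv⟩
    have hd := hD r hr
    rw [div_eq_iff hd] at hu hv
    have hsq : u ^ 2 + v ^ 2 = r := by
      simp only [oscillatorEliminant, eval_sub, eval_mul, eval_pow, eval_X, hu, hv] at hr
      refine mul_right_cancel₀ (pow_ne_zero 2 hd) ?_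
      linear_combination -hr
    rw [hsq]
    simp [oscillatorDet, oscillatorNumU, oscillatorNumV] at hu hv hd
    constructor
    · refine mul_right_cancel₀ hd ?_
      linear_combination -(a 0 * r + a 1) * hu - a 2 * hv
    · refine mul_right_cancel₀ hd ?_
      linear_combination -(b 0 * r + b 2) * hv - b 1 * hu

theorem injOn_oscillatorSolution {a b : Fin 4 → ℂ}
    (h : IsCoprime (oscillatorEliminant a b) (oscillatorDet a b)) :
    Set.InjOn (fun r => ((oscillatorNumU a b).eval r / (oscillatorDet a b).eval r,
        (oscillatorNumV a b).eval r / (oscillatorDet a b).eval r))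
      ((oscillatorEliminant a b).rootSet ℂ) := by
  have key : ∀ r ∈ (oscillatorEliminant a b).rootSet ℂ,
      r = ((oscillatorNumU a b).eval r / (oscillatorDet a b).eval r) ^ 2 +
        ((oscillatorNumV a b).eval r / (oscillatorDet a b).eval r) ^ 2 := by
    intro r hr
    have hr' : (oscillatorEliminant a b).eval r = 0 := by
      simpa only [coe_aeval_eq_eval] using (mem_rootSet.mp hr).2
    have hd : (oscillatorDet a b).eval r ≠ 0 := by
      intro hd
      obtain ⟨p, q, hpq⟩ := h
      simpa [hr', hd] using congrArg (eval r) hpq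
    simp only [oscillatorEliminant, eval_sub, eval_mul, eval_pow, eval_X] at hr'
    field_simp
    linear_combination hr'
  intro r hr s hs hrs
  rw [key r hr, key s hs, (Prod.mk.inj hrs).1, (Prod.mk.inj hrs).2]

theorem encard_oscillatorSolutions {a b : Fin 4 → ℂ} (hab : a 0 * b 0 ≠ 0)
    (h : oscillatorResultant a b ≠ 0) : (oscillatorSolutions a b).encard = 5 := by
  have hco := isCoprime_of_oscillatorResultant_ne_zero h
  have hdeg := natDegree_oscillatorEliminant hab
  have h0 : oscillatorEliminant a b ≠ 0 := by
    intro h0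
    simp [h0] at hdeg
  rw [oscillatorSolutions_eq_image h0 hco.of_mul_right_right,
    (injOn_oscillatorSolution hco.of_mul_right_right).encard_image,
    Set.encard_eq_coe_toFinset_card, Set.toFinset_card,
    card_rootSet_eq_natDegree hco.of_mul_right_left (IsAlgClosed.splits _), hdeg]
  rfl

theorem oscillatorResultant_ne_zero_of_coupled_cubic :
    oscillatorResultant ![(1 : ℂ), 0, 1, 0] ![(1 : ℂ), 0, 0, 1] ≠ 0 := by
  have hD : oscillatorDet ![(1 : ℂ), 0, 1, 0] ![(1 : ℂ), 0, 0, 1] = X ^ 2 := by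
    simp [oscillatorDet]
    ring
  have hP : oscillatorEliminant ![(1 : ℂ), 0, 1, 0] ![(1 : ℂ), 0, 0, 1] = X ^ 5 - X ^ 2 - 1 := by
    rw [oscillatorEliminant, hD]
    simp [oscillatorNumU, oscillatorNumV]
    ring
  have hP' : derivative (X ^ 5 - X ^ 2 - 1 : ℂ[X]) = 5 * X ^ 4 - 2 * X := by
    simp [show (C 4 : ℂ[X]) = 4 from rfl]
    ring
  have hsep : IsCoprime (X ^ 5 - X ^ 2 - 1 : ℂ[X]) (5 * X ^ 4 - 2 * X) := by
    have hc : C (48495⁻¹ : ℂ) * 48495 = 1 := by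
      rw [← C_ofNat, ← C_mul, ← C_1]
      norm_num
    -- Euclid's algorithm: `5P - XP' = -(3X² + 5)`, `9P' ≡ 125 - 18X` mod `3X² + 5`, and `48495 =
    -- 3(125² - (18X)²) + 324(3X² + 5)`.
    refine ⟨C (48495⁻¹ : ℂ) * (-5 * (324 - 3 * (18 * X + 125) * (15 * X ^ 2 - 25))),
      C (48495⁻¹ : ℂ) * ((324 - 3 * (18 * X + 125) * (15 * X ^ 2 - 25)) * X +
        27 * (18 * X + 125)), ?_⟩
    linear_combination hc
  have hX : IsCoprime (X ^ 5 - X ^ 2 - 1 : ℂ[X]) (X ^ 2) :=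
    ⟨-1, X ^ 3 - 1, by ring⟩
  have hres := resultant_ne_zero _ _ (hsep.mul_right hX)
  -- `hres` uses the actual degrees, which here equal the formal ones.
  have h5 : (X ^ 5 - X ^ 2 - 1 : ℂ[X]).natDegree = 5 := by compute_degree!
  have h6 : ((5 * X ^ 4 - 2 * X) * X ^ 2 : ℂ[X]).natDegree = 6 := by compute_degree!
  rw [h5, h6] at hres
  rwa [oscillatorResultant, hP, hD, hP']

/-- Here `g = v(r - 2)`: the line `v = 0` carries three roots of a cubic, and on the circle `r = 2`
the equation `f = 0` becomes a line meeting it in two rational points. -/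
theorem oscillatorSolutions_real_example :
    oscillatorSolutions ![1, -7, -1, 6] ![1, 0, -2, 0] =
      {(1, 0), (2, 0), (-3, 0), (1, 1), (17 / 13, -7 / 13)} := by
  ext ⟨u, v⟩
  simp only [oscillatorSolutions, oscillatorF, oscillatorG, Set.mem_ofPred_eq,
    Set.mem_insert_iff, Set.mem_singleton_iff, Prod.mk.injEq, Matrix.cons_val]
  constructor
  · rintro ⟨hf, hg⟩
    have hv : v * (u ^ 2 + v ^ 2 - 2) = 0 := by linear_combination hg
    rcases mul_eq_zero.mp hv with rfl | hr
    · have hu : (u - 1) * ((u - 2) * (u + 3)) = 0 := by linear_combination hf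
      rcases mul_eq_zero.mp hu with h | h
      · exact Or.inl ⟨sub_eq_zero.mp h, rfl⟩
      rcases mul_eq_zero.mp h with h | h
      · exact Or.inr (Or.inl ⟨sub_eq_zero.mp h, rfl⟩)
      · exact Or.inr (Or.inr (Or.inl ⟨eq_neg_of_add_eq_zero_left h, rfl⟩))
    · have hl : v = 6 - 5 * u := by linear_combination u * hr - hf
      subst hl
      have hu : (u - 1) * (13 * u - 17) = 0 := by linear_combination hr / 2
      rcases mul_eq_zero.mp hu with h | h
      · obtain rfl := sub_eq_zero.mp h
        norm_num
      · obtain rfl : u = 17 / 13 := by linear_combination h / 13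
        norm_num
  · rintro (⟨rfl, rfl⟩ | ⟨rfl, rfl⟩ | ⟨rfl, rfl⟩ | ⟨rfl, rfl⟩ | ⟨rfl, rfl⟩) <;> norm_num

theorem holdsForGeneral_encard_oscillatorSolutions :
    HoldsForGeneral (fun p : Fin 4 ⊕ Fin 4 → ℂ =>
      (oscillatorSolutions (fun i => p (Sum.inl i)) (fun i => p (Sum.inr i))).encard = 5) := by
  -- Generic parameters: the coordinates of `ℂ⁸` themselves.
  let a : Fin 4 → MvPolynomial (Fin 4 ⊕ Fin 4) ℂ := fun i => MvPolynomial.X (Sum.inl i)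
  let b : Fin 4 → MvPolynomial (Fin 4 ⊕ Fin 4) ℂ := fun i => MvPolynomial.X (Sum.inr i)
  have heval (p : Fin 4 ⊕ Fin 4 → ℂ) :
      MvPolynomial.eval p (a 0 * b 0 * oscillatorResultant a b) =
        p (Sum.inl 0) * p (Sum.inr 0) *
          oscillatorResultant (fun i => p (Sum.inl i)) (fun i => p (Sum.inr i)) := by
    rw [map_mul, map_mul, map_oscillatorResultant]
    simp [a, b, Function.comp_def]
  refine ⟨{a 0 * b 0 * oscillatorResultant a b}, ?_, ?_⟩
  · intro huniv
    have hp := huniv.ge (Set.mem_univ (Sum.elim ![1, 0, 1, 0] ![1, 0, 0, 1])) _ rfl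
    rw [heval] at hp
    exact oscillatorResultant_ne_zero_of_coupled_cubic (by simpa using hp)
  · rintro p hp q rfl
    rw [heval]
    by_contra hne
    exact hp (encard_oscillatorSolutions (left_ne_zero_of_mul hne) (right_ne_zero_of_mul hne))

theorem theorem3p1 :
    HoldsForGeneral (fun p : Fin 4 ⊕ Fin 4 → ℂ =>
      (oscillatorSolutions (fun i => p (Sum.inl i)) (fun i => p (Sum.inr i))).encard = 5) ∧
    ∃ a b : Fin 4 → ℝ,
      (oscillatorSolutions (fun i => (a i : ℂ)) (fun i => (b i : ℂ))).encard = 5 ∧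
      ∀ x ∈ oscillatorSolutions (fun i => (a i : ℂ)) (fun i => (b i : ℂ)),
        ∃ s t : ℝ, x = ((s : ℂ), (t : ℂ)) := by
  refine ⟨holdsForGeneral_encard_oscillatorSolutions, ![1, -7, -1, 6], ![1, 0, -2, 0], ?_⟩
  have ha : (fun i => ((![1, -7, -1, 6] : Fin 4 → ℝ) i : ℂ)) = ![1, -7, -1, 6] := by
    ext i
    fin_cases i <;> simp
  have hb : (fun i => ((![1, 0, -2, 0] : Fin 4 → ℝ) i : ℂ)) = ![1, 0, -2, 0] := by
    ext i
    fin_cases i <;> simp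
  rw [ha, hb, oscillatorSolutions_real_example]
  constructor
  · repeat rw [Set.encard_insert_of_notMem (by norm_num [Prod.ext_iff])]
    rw [Set.encard_singleton]
    norm_num
  · rintro x (rfl | rfl | rfl | rfl | rfl)
    · exact ⟨1, 0, by simp⟩
    · exact ⟨2, 0, by simp⟩
    · exact ⟨-3, 0, by simp⟩
    · exact ⟨1, 1, by simp⟩
    · exact ⟨17 / 13, -7 / 13, by simp⟩
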